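/- **Proposition (subentropy is a lower bound for min-entropy).** Let $\rho$ be a state (density matrix: a positive semidefinite complex $n\times n$ matrix of trace one) of a quantum system with $n$-dimensional Hilbert space, with eigenvalues $\underline{\lambda}=(\lambda_1,\dots,\lambda_n)$ counted with multiplicity. For $\underline{v}=(v_1,\dots,v_n)$ with pairwise distinct, strictly positive entries put $$F(\underline{v})=-\sum_{i=1}^n\frac{v_i^{\,n}}{\prod_{j\neq i}(v_i-v_j)}\,\ln v_i .$$ The subentropy $Q(\rho)$ is defined to be $F(\underline{\lambda})$ if the $\lambda_i$ are distinct and positive, and if eigenvalues coincide or vanish it is the limit of $F(\underline{v})$ as $\underline{v}\to\underline{\lambda}$ through vectors with pairwise distinct, strictly positive entries. Then: - $Q(\rho)$ is well defined: for every state $\rho$ this limit exists and is finite, and it equals $F(\underline{\lambda})$ when the $\lambda_i$ are distinct and positive; - with the min-entropy $H_{\min}(\rho)=-\ln\lambda_{\max}(\rho)$, where $\lambda_{\max}(\rho)$ is the largest eigenvalue of $\rho$, $$Q(\rho)\le H_{\min}(\rho).$$ -/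

import Mathlib

open Filter Topology
open scoped ComplexOrder

noncomputable section

/-- A state (density matrix) of a quantum system with Hilbert space `ℂ^d`: a positive semidefinite
complex `d × d` matrix of trace one. -/
structure QuantumState (d : Type*) [Fintype d] where
  mat : Matrix d d ℂ
  posSemidef : mat.PosSemidef
  trace_eq_one : mat.trace = 1

namespace QuantumState

variable {d : Type*} [Fintype d] [DecidableEq d]

/-- The eigenvalues of a state, repeated according to multiplicity. -/
def eigenvalues (ρ : QuantumState d) : d → ℝ :=
  ρ.posSemidef.isHermitian.eigenvalues

end QuantumState

/-- The vectors with pairwise distinct and strictly positive entries. -/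
def genericSpectra (d : Type*) : Set (d → ℝ) :=
  {v | Function.Injective v ∧ ∀ i, 0 < v i}

/-- The expression `F(v) = - ∑ i, v i ^ n / ∏_{j ≠ i} (v i - v j) * log (v i)`, where `n` is the
number of entries of `v`. It is symmetric in the entries, and it is meaningful as it stands for
`v ∈ genericSpectra d`. -/
def subentropyFormula {d : Type*} [Fintype d] [DecidableEq d] (v : d → ℝ) : ℝ :=
  -∑ i, v i ^ Fintype.card d / (∏ j ∈ Finset.univ.erase i, (v i - v j)) * Real.log (v i)

namespace QuantumState

variable {d : Type*} [Fintype d] [DecidableEq d]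

/-- The subentropy `Q(ρ)`: the limit of `F(v)` as `v`, with distinct and positive entries, tends to
the vector of eigenvalues of `ρ`. -/
def subentropy (ρ : QuantumState d) : ℝ :=
  extendFrom (genericSpectra d) subentropyFormula ρ.eigenvalues

/-- The largest eigenvalue of a state. -/
def maxEigenvalue (ρ : QuantumState d) : ℝ :=
  ⨆ i, ρ.eigenvalues i

/-- The min-entropy `H_min(ρ) = - ln λ_max(ρ)`. -/
def minEntropy (ρ : QuantumState d) : ℝ :=
  -Real.log ρ.maxEigenvalue

end QuantumState

end

/-! Write `n` for the number of entries, `S` for their sum and `c i` for the coefficient of `-log (v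
i)` in `F(v)`. Since `-log a` is the integral over `t > 0` of `1/(t+a) - 1/(1+t)`, summing with the
weights `c i` gives, by partial fractions and `∑ c i = S`, the integral of `1 - S/(1+t) - ∏ t/(t + v
i)`. No differences `v i - v j` remain, so dominated convergence gives the limit at every
nonnegative spectrum (`tendsto_subentropyFormula`). If `S = 1`, bounding the product over `i ≠ m`
from below makes the integrand at most `1/(t + v m) - 1/(1+t)`, whose integral is `-log (v m)`; take
`v m` maximal. -/

open Polynomial in
theorem degree_X_pow_card_sub_nodal_lt {ι : Type*} [Fintype ι] (v : ι → ℝ) :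
    (X ^ Fintype.card ι - Lagrange.nodal Finset.univ v).degree <
      ((Finset.univ : Finset ι).card : WithBot ℕ) := by
  have h := degree_sub_lt_left (p := (X : ℝ[X]) ^ Fintype.card ι) (q := Lagrange.nodal Finset.univ v)
    (by rw [degree_X_pow, Lagrange.degree_nodal, Finset.card_univ]) (pow_ne_zero _ X_ne_zero)
    (by rw [(monic_X_pow _).leadingCoeff, Lagrange.nodal_monic.leadingCoeff])
  rwa [degree_X_pow, ← Finset.card_univ] at h

open Polynomial in
/-- Partial fraction expansion of `1 - t ^ n / ∏ (t + v i)`, where `n` is the number of poles. -/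
theorem sum_pow_card_div_prod_sub_mul_inv_add {ι : Type*} [Fintype ι] [DecidableEq ι]
    {v : ι → ℝ} (hv : Function.Injective v) {t : ℝ} (ht : ∀ i, t + v i ≠ 0) :
    ∑ i, v i ^ Fintype.card ι / (∏ j ∈ Finset.univ.erase i, (v i - v j)) * (t + v i)⁻¹ =
      1 - ∏ i, t / (t + v i) := by
  set N := Lagrange.nodal Finset.univ v with hN
  have hdeg := degree_X_pow_card_sub_nodal_lt v
  -- The leading terms cancel and `N` vanishes at the nodes, so interpolating the values `v i ^ n`
  -- is exact; evaluation at `-t` gives the expansion.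
  have hP : X ^ Fintype.card ι - N =
      Lagrange.interpolate Finset.univ v (fun i => v i ^ Fintype.card ι) := by
    refine Lagrange.eq_interpolate_of_eval_eq _ hv.injOn hdeg fun i hi => ?_
    simp [hN, Lagrange.eval_nodal_at_node hi]
  have hne : ∀ i ∈ Finset.univ, -t ≠ v i := fun i _ h => ht i (by rw [← h]; ring)
  have h := congrArg (eval (-t)) hP
  have hNt : eval (-t) N = (-1) ^ Fintype.card ι * ∏ i, (t + v i) := by
    rw [hN, Lagrange.eval_nodal, ← Finset.card_univ, ← Finset.prod_const, ← Finset.prod_mul_distrib]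
    exact Finset.prod_congr rfl fun i _ => by ring
  rw [Lagrange.eval_interpolate_not_at_node _ hne, ← hN, eval_sub, hNt, eval_pow, eval_X,
    neg_pow, ← mul_sub, mul_assoc] at h
  have h' := mul_left_cancel₀ (pow_ne_zero _ (by norm_num)) h
  have hprod : ∏ i, (t + v i) ≠ 0 := Finset.prod_ne_zero_iff.2 fun i _ => ht i
  have hsum : ∑ i, Lagrange.nodalWeight Finset.univ v i * (-t - v i)⁻¹ * v i ^ Fintype.card ι =
      -∑ i, v i ^ Fintype.card ι / (∏ j ∈ Finset.univ.erase i, (v i - v j)) * (t + v i)⁻¹ := by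
    rw [← Finset.sum_neg_distrib]
    refine Finset.sum_congr rfl fun i _ => ?_
    rw [Lagrange.nodalWeight, Finset.prod_inv_distrib, show -t - v i = -(t + v i) by ring, inv_neg]
    ring
  rw [hsum] at h'
  rw [Finset.prod_div_distrib, Finset.prod_const, Finset.card_univ]
  apply mul_left_cancel₀ hprod
  rw [mul_sub, mul_one, mul_div_cancel₀ _ hprod]
  linarith

-- Compare coefficients of `X ^ (n - 1)` in the same interpolation identity.
open Polynomial in
theorem sum_pow_card_div_prod_sub {ι : Type*} [Fintype ι] [DecidableEq ι] [Nonempty ι]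
    {v : ι → ℝ} (hv : Function.Injective v) :
    ∑ i, v i ^ Fintype.card ι / (∏ j ∈ Finset.univ.erase i, (v i - v j)) = ∑ i, v i := by
  have h := Lagrange.coeff_eq_sum hv.injOn (degree_X_pow_card_sub_nodal_lt v)
  have hcard : Fintype.card ι - 1 ≠ Fintype.card ι :=
    (Nat.sub_lt Fintype.card_pos one_pos).ne
  rw [coeff_sub, Lagrange.nodal_eq, prod_X_sub_C_coeff_card_pred _ _ (by simp [Fintype.card_pos]),
    Finset.card_univ, coeff_X_pow, if_neg hcard, zero_sub, neg_neg] at h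
  rw [h]
  refine Finset.sum_congr rfl fun i hi => ?_
  rw [← Lagrange.nodal_eq, eval_sub, Lagrange.eval_nodal_at_node hi, eval_pow, eval_X, sub_zero]

/-- The integrand of the integral representation of the subentropy. -/
noncomputable def subentropyIntegrand {ι : Type*} [Fintype ι] (v : ι → ℝ) (t : ℝ) : ℝ :=
  1 - (∑ i, v i) / (1 + t) - ∏ i, t / (t + v i)

theorem one_sub_sum_div_le_prod {ι : Type*} (s : Finset ι) {v : ι → ℝ} (hv : ∀ i, 0 ≤ v i)
    {t : ℝ} (ht : 0 < t) : 1 - (∑ i ∈ s, v i) / t ≤ ∏ i ∈ s, t / (t + v i) := by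
  classical
  induction s using Finset.induction_on with
  | empty => simp
  | insert a s ha ih =>
    rw [Finset.sum_insert ha, Finset.prod_insert ha]
    have h0 := hv a
    have hta : 0 < t + v a := by linarith
    have h1 : t / (t + v a) ≤ 1 := (div_le_one hta).2 (by linarith)
    have h2 : 1 - v a / t ≤ t / (t + v a) := by
      rw [← sub_nonneg]
      have : t / (t + v a) - (1 - v a / t) = v a ^ 2 / (t * (t + v a)) := by field_simp; ring
      rw [this]; positivity
    have h3 : 0 ≤ (∑ i ∈ s, v i) / t := div_nonneg (Finset.sum_nonneg fun i _ => hv i) ht.le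
    have h4 : 0 ≤ t / (t + v a) := by positivity
    calc 1 - (v a + ∑ i ∈ s, v i) / t = (1 - v a / t) - (∑ i ∈ s, v i) / t := by ring
      _ ≤ t / (t + v a) - t / (t + v a) * ((∑ i ∈ s, v i) / t) := by
        have := mul_le_mul_of_nonneg_right h1 h3
        linarith
      _ = t / (t + v a) * (1 - (∑ i ∈ s, v i) / t) := by ring
      _ ≤ _ := mul_le_mul_of_nonneg_left ih h4

/-- Expanding `∏ (1 + v i / t)` leaves only nonnegative terms beyond `1 + S/t`. -/
theorem prod_le_div_add_sum {ι : Type*} (s : Finset ι) {v : ι → ℝ} (hv : ∀ i, 0 ≤ v i)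
    {t : ℝ} (ht : 0 < t) : ∏ i ∈ s, t / (t + v i) ≤ t / (t + ∑ i ∈ s, v i) := by
  classical
  induction s using Finset.induction_on with
  | empty => simp [ht.ne']
  | insert a s ha ih =>
    rw [Finset.sum_insert ha, Finset.prod_insert ha]
    have h0 := hv a
    have hS : 0 ≤ ∑ i ∈ s, v i := Finset.sum_nonneg fun i _ => hv i
    refine (mul_le_mul_of_nonneg_left ih (by positivity)).trans ?_
    rw [div_mul_div_comm, div_le_div_iff₀ (by positivity) (by positivity)]
    have : 0 ≤ t * (v a * ∑ i ∈ s, v i) := by positivity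
    nlinarith

/-- The terms of order `1/t` cancel at infinity, leaving decay like `1/t^2`. Only `M` enters the
bound, so one dominating function serves all spectra near a given one. -/
theorem abs_subentropyIntegrand_le {ι : Type*} [Fintype ι] {v : ι → ℝ} (hv : ∀ i, 0 ≤ v i)
    {M : ℝ} (hM : ∑ i, v i ≤ M) {t : ℝ} (ht : 0 < t) :
    |subentropyIntegrand v t| ≤ 2 * (1 + M) ^ 2 * (1 + t ^ 2)⁻¹ := by
  have hl := one_sub_sum_div_le_prod Finset.univ hv ht
  have hu := prod_le_div_add_sum Finset.univ hv ht
  have hS : 0 ≤ ∑ i, v i := Finset.sum_nonneg fun i _ => hv i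
  have hp : 0 ≤ ∏ i, t / (t + v i) :=
    Finset.prod_nonneg fun i _ => div_nonneg ht.le (by linarith [hv i])
  unfold subentropyIntegrand
  set S := ∑ i, v i
  set P := ∏ i, t / (t + v i)
  have hMS : 2 * (1 + S) ^ 2 * (1 + t ^ 2)⁻¹ ≤ 2 * (1 + M) ^ 2 * (1 + t ^ 2)⁻¹ := by gcongr
  refine le_trans ?_ hMS
  rcases le_total t 1 with h1 | h1
  · have hb : 1 + S ≤ 2 * (1 + S) ^ 2 * (1 + t ^ 2)⁻¹ := by
      rw [← div_eq_mul_inv, le_div_iff₀ (by positivity)]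
      have : t ^ 2 ≤ 1 := by nlinarith
      nlinarith
    have hP1 : t / (t + S) ≤ 1 := (div_le_one (by linarith)).2 (by linarith)
    have h2 : S / (1 + t) ≤ S := div_le_self hS (by linarith)
    have h3 : 0 ≤ S / (1 + t) := by positivity
    rw [abs_le]; constructor <;> linarith
  · have hb : (S + S ^ 2) / t ^ 2 ≤ 2 * (1 + S) ^ 2 * (1 + t ^ 2)⁻¹ := by
      rw [← div_eq_mul_inv, div_le_div_iff₀ (by positivity) (by positivity)]
      have : 1 ≤ t ^ 2 := by nlinarith
      nlinarith [mul_nonneg hS (by positivity : 0 ≤ t ^ 2), mul_nonneg (mul_nonneg hS hS) (by linarith : 0 ≤ t ^ 2 - 1), mul_nonneg hS (by linarith : 0 ≤ t ^ 2 - 1)]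
    have h2 : S / t - S / (1 + t) ≤ (S + S ^ 2) / t ^ 2 := by
      have : S / t - S / (1 + t) = S / (t * (1 + t)) := by field_simp; ring
      rw [this]
      calc S / (t * (1 + t)) ≤ S / t ^ 2 := by gcongr; nlinarith
        _ ≤ _ := by gcongr; nlinarith
    have h3 : -((S + S ^ 2) / t ^ 2) ≤ 1 - S / (1 + t) - t / (t + S) := by
      have : 1 - S / (1 + t) - t / (t + S) = -((S ^ 2 - S) / ((t + S) * (1 + t))) := by
        field_simp; ring
      rw [this, neg_le_neg_iff]
      calc (S ^ 2 - S) / ((t + S) * (1 + t)) ≤ (S + S ^ 2) / ((t + S) * (1 + t)) := by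
            gcongr; linarith
        _ ≤ _ := by gcongr; nlinarith
    rw [abs_le]; constructor <;> linarith

theorem measurable_subentropyIntegrand {ι : Type*} [Fintype ι] (v : ι → ℝ) :
    Measurable (subentropyIntegrand v) := by
  unfold subentropyIntegrand
  fun_prop

open MeasureTheory Set in
theorem integrableOn_subentropyIntegrand {ι : Type*} [Fintype ι] {v : ι → ℝ} (hv : ∀ i, 0 ≤ v i) :
    IntegrableOn (subentropyIntegrand v) (Ioi 0) := by
  refine Integrable.mono' ((integrable_inv_one_add_sq.const_mul
    (2 * (1 + ∑ i, v i) ^ 2)).integrableOn) (measurable_subentropyIntegrand v).aestronglyMeasurable ?_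
  filter_upwards [ae_restrict_mem measurableSet_Ioi] with t ht
  exact abs_subentropyIntegrand_le hv le_rfl ht

open MeasureTheory Set in
theorem integral_inv_add_sub_inv_one_add {a : ℝ} (ha : 0 < a) :
    IntegrableOn (fun t : ℝ => (t + a)⁻¹ - (1 + t)⁻¹) (Ioi 0) ∧
      ∫ t in Ioi (0 : ℝ), ((t + a)⁻¹ - (1 + t)⁻¹) = -Real.log a := by
  have hd : ∀ t ∈ Ici (0 : ℝ), HasDerivAt (fun t => Real.log (t + a) - Real.log (1 + t))
      ((t + a)⁻¹ - (1 + t)⁻¹) t := by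
    intro t ht
    have ht : 0 ≤ t := ht
    have h1 := ((hasDerivAt_id t).add_const a).log (by simp only [id]; positivity)
    have h2 := ((hasDerivAt_id t).const_add 1).log (by simp only [id]; positivity)
    simp only [one_div, id] at h1 h2
    exact h1.sub h2
  have hlim : Tendsto (fun t : ℝ => Real.log (t + a) - Real.log (1 + t)) atTop (𝓝 0) := by
    have h1 : Tendsto (fun t : ℝ => (t + a) / (1 + t)) atTop (𝓝 1) := by
      have h2 : Tendsto (fun t : ℝ => 1 + (a - 1) / (1 + t)) atTop (𝓝 (1 + 0)) :=
        tendsto_const_nhds.add (tendsto_const_nhds.div_atTop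
          (tendsto_atTop_add_const_left _ 1 tendsto_id))
      rw [add_zero] at h2
      refine h2.congr' ?_
      filter_upwards [eventually_gt_atTop 0] with t ht
      field_simp
      ring
    have h3 := (Real.continuousAt_log one_ne_zero).tendsto.comp h1
    rw [Real.log_one] at h3
    refine h3.congr' ?_
    filter_upwards [eventually_gt_atTop 0] with t ht
    exact Real.log_div (by positivity) (by positivity)
  have hint : IntegrableOn (fun t : ℝ => (t + a)⁻¹ - (1 + t)⁻¹) (Ioi 0) := by
    -- The integrand has constant sign, so the finite limit of the antiderivative already gives
    -- integrability.
    rcases le_total a 1 with h | h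
    · refine integrableOn_Ioi_deriv_of_nonneg' hd (fun t ht => ?_) hlim
      have ht : 0 < t := ht
      exact sub_nonneg.2 (inv_anti₀ (by positivity) (by linarith))
    · refine integrableOn_Ioi_deriv_of_nonpos' hd (fun t ht => ?_) hlim
      have ht : 0 < t := ht
      exact sub_nonpos.2 (inv_anti₀ (by positivity) (by linarith))
  refine ⟨hint, ?_⟩
  rw [integral_Ioi_of_hasDerivAt_of_tendsto' hd hint hlim]
  simp

open MeasureTheory Set in
theorem subentropyFormula_eq_integral {ι : Type*} [Fintype ι] [DecidableEq ι] [Nonempty ι]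
    {v : ι → ℝ} (hv : v ∈ genericSpectra ι) :
    subentropyFormula v = ∫ t in Ioi (0 : ℝ), subentropyIntegrand v t := by
  set c : ι → ℝ := fun i =>
    v i ^ Fintype.card ι / (∏ j ∈ Finset.univ.erase i, (v i - v j)) with hc
  have h1 : ∀ t ∈ Ioi (0 : ℝ), subentropyIntegrand v t =
      ∑ i, c i * ((t + v i)⁻¹ - (1 + t)⁻¹) := by
    intro t ht
    have hne : ∀ i, t + v i ≠ 0 := fun i => (add_pos ht (hv.2 i)).ne'
    simp_rw [mul_sub, Finset.sum_sub_distrib, ← Finset.sum_mul]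
    rw [hc, sum_pow_card_div_prod_sub_mul_inv_add hv.1 hne, sum_pow_card_div_prod_sub hv.1,
      subentropyIntegrand]
    ring
  rw [setIntegral_congr_fun measurableSet_Ioi h1, integral_finsetSum _ fun i _ =>
    ((integral_inv_add_sub_inv_one_add (hv.2 i)).1.const_mul (c i))]
  simp_rw [integral_const_mul, (integral_inv_add_sub_inv_one_add (hv.2 _)).2, mul_neg,
    Finset.sum_neg_distrib]
  rfl

open MeasureTheory Set in
theorem tendsto_subentropyFormula {ι : Type*} [Fintype ι] [DecidableEq ι] [Nonempty ι]
    {v : ι → ℝ} (hv : ∀ i, 0 ≤ v i) :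
    Tendsto subentropyFormula (𝓝[genericSpectra ι] v)
      (𝓝 (∫ t in Ioi (0 : ℝ), subentropyIntegrand v t)) := by
  have hgen : ∀ᶠ w in 𝓝[genericSpectra ι] v, w ∈ genericSpectra ι := self_mem_nhdsWithin
  have hsum : ∀ᶠ w in 𝓝[genericSpectra ι] v, ∑ i, w i ≤ ∑ i, v i + 1 := by
    have hcont : Continuous fun w : ι → ℝ => ∑ i, w i := by fun_prop
    exact nhdsWithin_le_nhds ((hcont.tendsto v).eventually_le_const (by linarith))
  refine Tendsto.congr' (hgen.mono fun w hw => (subentropyFormula_eq_integral hw).symm) ?_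
  refine tendsto_integral_filter_of_dominated_convergence
    (fun t => 2 * (1 + (∑ i, v i + 1)) ^ 2 * (1 + t ^ 2)⁻¹)
    (Eventually.of_forall fun w => (measurable_subentropyIntegrand w).aestronglyMeasurable) ?_
    (integrable_inv_one_add_sq.const_mul _).integrableOn ?_
  · filter_upwards [hgen, hsum] with w hw hs
    filter_upwards [ae_restrict_mem measurableSet_Ioi] with t ht
    exact abs_subentropyIntegrand_le (fun i => (hw.2 i).le) hs ht
  · filter_upwards [ae_restrict_mem measurableSet_Ioi] with t ht
    have hc : ContinuousAt (fun w : ι → ℝ => subentropyIntegrand w t) v := by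
      unfold subentropyIntegrand
      have h0 : ∀ i, t + v i ≠ 0 := fun i => (add_pos_of_pos_of_nonneg ht (hv i)).ne'
      refine ContinuousAt.sub (by fun_prop) (tendsto_finsetProd _ fun i _ => ?_)
      exact ContinuousAt.div continuousAt_const
        (continuousAt_const.add (continuous_apply i).continuousAt) (h0 i)
    exact hc.tendsto.mono_left nhdsWithin_le_nhds

/-- Adding `ε * (1, ..., n)` separates equal entries, and for small `ε > 0` keeps distinct ones
apart. Density makes the limit defining the subentropy unique. -/
theorem mem_closure_genericSpectra {ι : Type*} [Fintype ι] {v : ι → ℝ} (hv : ∀ i, 0 ≤ v i) :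
    v ∈ closure (genericSpectra ι) := by
  let e := Fintype.equivFin ι
  let w : ℝ → ι → ℝ := fun ε i => v i + ε * ((e i : ℕ) + 1)
  have hw : Tendsto w (𝓝[>] 0) (𝓝 v) := by
    have hcont : Continuous w := by fun_prop
    have h := hcont.tendsto 0
    have h0 : w 0 = v := by ext i; simp [w]
    rw [h0] at h
    exact h.mono_left nhdsWithin_le_nhds
  refine mem_closure_of_tendsto hw ?_
  have hinj : ∀ᶠ ε in 𝓝[>] (0 : ℝ), ∀ i j, i ≠ j → w ε i ≠ w ε j := by
    rw [eventually_all]; intro i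
    rw [eventually_all]; intro j
    by_cases hij : i = j
    · simp [hij]
    by_cases hvv : v i = v j
    · filter_upwards [self_mem_nhdsWithin] with ε hε _ h
      have hε : 0 < ε := hε
      simp only [w, hvv] at h
      have h' : ((e i : ℕ) : ℝ) = (e j : ℕ) := by
        have := mul_left_cancel₀ hε.ne' (add_left_cancel h)
        linarith
      exact hij (e.injective (Fin.ext (by exact_mod_cast h')))
    · have hcont : Continuous fun u : ι → ℝ => u i - u j := by fun_prop
      have := ((hcont.tendsto v).comp hw).eventually_ne (sub_ne_zero.2 hvv)
      filter_upwards [this] with ε hε _ h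
      exact hε (sub_eq_zero.2 h)
  filter_upwards [hinj, self_mem_nhdsWithin] with ε h1 hε
  have hε : 0 < ε := hε
  refine ⟨fun i j h => by_contra fun hij => h1 i j hij h, fun i => ?_⟩
  have := hv i
  simp only [w]
  positivity

theorem subentropyIntegrand_le {ι : Type*} [Fintype ι] {v : ι → ℝ} (hv : ∀ i, 0 ≤ v i)
    (hsum : ∑ i, v i = 1) (m : ι) {t : ℝ} (ht : 0 < t) :
    subentropyIntegrand v t ≤ (t + v m)⁻¹ - (1 + t)⁻¹ := by
  classical
  have hm := hv m
  have h1 := one_sub_sum_div_le_prod (Finset.univ.erase m) hv ht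
  have h2 := Finset.add_sum_erase Finset.univ v (Finset.mem_univ m)
  rw [hsum] at h2
  rw [show ∑ i ∈ Finset.univ.erase m, v i = 1 - v m by linarith] at h1
  have h3 := mul_le_mul_of_nonneg_left h1 (by positivity : 0 ≤ t / (t + v m))
  rw [Finset.mul_prod_erase Finset.univ (fun i => t / (t + v i)) (Finset.mem_univ m)] at h3
  -- Keeping the factor at `m` exact is what makes the bound collapse to a single pole.
  have h4 : t / (t + v m) * (1 - (1 - v m) / t) = 1 - (t + v m)⁻¹ := by field_simp; ring
  rw [subentropyIntegrand, hsum, one_div]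
  linarith

open MeasureTheory Set in
theorem integral_subentropyIntegrand_le {ι : Type*} [Fintype ι] {v : ι → ℝ} (hv : ∀ i, 0 ≤ v i)
    (hsum : ∑ i, v i = 1) {m : ι} (hm : 0 < v m) :
    ∫ t in Ioi (0 : ℝ), subentropyIntegrand v t ≤ -Real.log (v m) := by
  rw [← (integral_inv_add_sub_inv_one_add hm).2]
  exact setIntegral_mono_on (integrableOn_subentropyIntegrand hv)
    (integral_inv_add_sub_inv_one_add hm).1 measurableSet_Ioi
    fun t ht => subentropyIntegrand_le hv hsum m ht

namespace QuantumState

variable {d : Type*} [Fintype d] [DecidableEq d]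

theorem eigenvalues_nonneg (ρ : QuantumState d) (i : d) : 0 ≤ ρ.eigenvalues i :=
  ρ.posSemidef.eigenvalues_nonneg i

theorem sum_eigenvalues (ρ : QuantumState d) : ∑ i, ρ.eigenvalues i = 1 := by
  have h := ρ.posSemidef.isHermitian.trace_eq_sum_eigenvalues
  rw [ρ.trace_eq_one] at h
  apply Complex.ofReal_injective
  rw [Complex.ofReal_sum, Complex.ofReal_one]
  exact h.symm

end QuantumState

theorem mainTheorem2 {d : Type*} [Fintype d] [DecidableEq d] (ρ : QuantumState d) :
    (ρ.eigenvalues ∈ genericSpectra d → ρ.subentropy = subentropyFormula ρ.eigenvalues) ∧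
    Tendsto subentropyFormula (𝓝[genericSpectra d] ρ.eigenvalues) (𝓝 ρ.subentropy) ∧
    ρ.subentropy ≤ ρ.minEntropy := by
  have hv := ρ.eigenvalues_nonneg
  have hs := ρ.sum_eigenvalues
  have : Nonempty d := by
    by_contra h
    rw [not_nonempty_iff] at h
    simp at hs
  have hlim := tendsto_subentropyFormula hv
  have hQ : ρ.subentropy = _ := extendFrom_eq (mem_closure_genericSpectra hv) hlim
  refine ⟨fun h => hQ.trans (subentropyFormula_eq_integral h).symm, hQ ▸ hlim, ?_⟩
  obtain ⟨m, hm⟩ := exists_eq_ciSup_of_finite (f := ρ.eigenvalues)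
  -- Trace one rules out a zero maximum, where `Real.log` would take its default value.
  have hpos : 0 < ρ.eigenvalues m := by
    by_contra h
    have hle : ∀ i, ρ.eigenvalues i ≤ 0 := fun i =>
      ((le_ciSup (Set.finite_range _).bddAbove i).trans_eq hm.symm).trans (not_lt.1 h)
    linarith [Finset.sum_nonpos fun i (_ : i ∈ Finset.univ) => hle i]
  rw [hQ, QuantumState.minEntropy, QuantumState.maxEigenvalue, ← hm]
  exact integral_subentropyIntegrand_le hv hs hpos
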